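/- Let $d\in\mathbb N$ and let $H^2=H^2(\mathbb B^d_{\mathbb N})\cong \ell^2(\mathbb F^d)$ be the full Fock space, i.e. the Hilbert space of power series $f=\sum_{\alpha}\hat f_\alpha \mathfrak z^\alpha$ in $d$ non-commuting variables, indexed by the words $\alpha$ in $d$ letters, with $\sum_\alpha|\hat f_\alpha|^2<\infty$. Such an $f$ is evaluated at strict row contractions $Z=(Z_1,\dots,Z_d)$ (the row operator $(Z_1,\dots,Z_d)$ has norm $<1$) by $f(Z)=\sum_\alpha \hat f_\alpha Z^\alpha$. Let $L=(L_1,\dots,L_d)$ be the left free shifts on $H^2$ (left multiplication by the variables). For $h\in H^2$ let $\mathrm{Sing}(h)$ be the set of all pairs $(Z,y)$, where $Z$ is a strict row contraction on $\mathbb C^n$, $n\ge 1$, or on $\mathbb C^\infty:=\ell^2(\mathbb N)$, and $y$ is a vector of that space with $y^*h(Z)=0$, and let $$\mathscr S(h)=\{f\in H^2 : y^*f(Z)=0 \text{ for all } (Z,y)\in \mathrm{Sing}(h)\}.$$ A left multiplier $\Theta\in H^\infty$ (a power series for which left multiplication $\Theta(L)=M^L_\Theta$ is a bounded operator on $H^2$)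 is *inner* if $\Theta(L)$ is an isometry, and an inner $\Theta$ is *Blaschke* if $\mathrm{Ran}\,\Theta(L)=\mathscr S(\Theta)$. **Statement.** Let $p\in\mathbb C\{\mathfrak z_1,\dots,\mathfrak z_d\}$ be a homogeneous free polynomial. Then $p$ is a constant multiple of an NC Blaschke inner: there are $c\in\mathbb C$ and an NC Blaschke inner $B\in H^\infty$ with $p=c\,B$, that is, $p(L)=c\,B(L)$. Moreover $\mathscr S(p)=\mathrm{Ran}\,p(L)$. -/

import Mathlib

noncomputable section

namespace NCHardy

/-- The free (noncommutative) Hardy space `H²` in `d` variables: the full Fock space over `ℂ^d`,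
realised as the square-summable families of coefficients indexed by words in `d` letters.  An
element `f` stands for the power series `∑ α, f α • 𝔷^α`. -/
abbrev Fock (d : ℕ) : Type := lp (fun _ : FreeMonoid (Fin d) => ℂ) 2

/-! ### Evaluation at strict row contractions -/

section Evaluation

variable {d : ℕ} {E : Type*} [NormedAddCommGroup E] [InnerProductSpace ℂ E]

/-- The row operator `E ⊗ ℂ^d → E`, `(x₁, …, x_d) ↦ Z₁ x₁ + ⋯ + Z_d x_d`, where the direct sum of
`d` copies of `E` carries its Hilbert space norm. -/
def rowOperator (Z : Fin d → E →L[ℂ] E) : PiLp 2 (fun _ : Fin d => E) →L[ℂ] E :=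
  ∑ i, (Z i).comp (PiLp.proj 2 (fun _ : Fin d => E) i)

/-- A tuple is a strict row contraction if its row operator has norm less than one. -/
def IsStrictRowContraction (Z : Fin d → E →L[ℂ] E) : Prop :=
  ‖rowOperator Z‖ < 1

/-- The value `f(Z) = ∑ α, f α • Z^α`, where `Z^α = Z_{i₁} ⋯ Z_{iₙ}` for the word `α = i₁ ⋯ iₙ`.
At a strict row contraction the family is (unconditionally) summable in operator norm. -/
def eval (f : Fock d) (Z : Fin d → E →L[ℂ] E) : E →L[ℂ] E :=
  ∑' α : FreeMonoid (Fin d), f α • FreeMonoid.lift Z α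

variable (E) in
/-- The part of the left singularity locus of `h` in level `E`: all pairs `(Z, y)` of a strict row
contraction `Z` on `E` and a vector `y` with `y^* h(Z) = 0`. -/
def singLocus (h : Fock d) : Set ((Fin d → E →L[ℂ] E) × E) :=
  {q | IsStrictRowContraction q.1 ∧ ∀ x : E, inner ℂ q.2 (eval h q.1 x) = 0}

variable (E) in
/-- The elements `f` of `H²` with `y^* f(Z) = 0` for all `(Z, y)` in level `E` of the left
singularity locus of `h`. -/
def levelSingSpace (h : Fock d) : Set (Fock d) :=
  {f | ∀ q ∈ singLocus E h, ∀ x : E, inner ℂ q.2 (eval f q.1 x) = 0}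

end Evaluation

/-- The singularity space `𝒮(h)`: all `f` in `H²` with `y^* f(Z) = 0` for all `(Z, y)` in the left
singularity locus of `h`, over all finite levels `ℂ^n`, `n ≥ 1`, and the infinite level `ℓ²(ℕ)`. -/
def singSpace {d : ℕ} (h : Fock d) : Set (Fock d) :=
  {f | (∀ n : ℕ, 1 ≤ n → f ∈ levelSingSpace (EuclideanSpace ℂ (Fin n)) h) ∧
    f ∈ levelSingSpace (lp (fun _ : ℕ => ℂ) 2) h}

/-! ### Left multipliers, inner and Blaschke inner multipliers -/

/-- The Cauchy product of two power series in noncommuting variables: the coefficient at the word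
`γ` is the sum of `f α * g β` over all factorizations `γ = α β`. -/
def cauchyProduct {d : ℕ} (f g : FreeMonoid (Fin d) → ℂ) (γ : FreeMonoid (Fin d)) : ℂ :=
  ∑ k ∈ Finset.range (γ.length + 1),
    f (FreeMonoid.ofList (γ.toList.take k)) * g (FreeMonoid.ofList (γ.toList.drop k))

/-- The free Hardy algebra `H^∞`, as the left multiplier algebra of `H²`: an element is a power
series `symbol` in `H²` such that left multiplication by it is a bounded operator `op` on `H²`. -/
structure LeftMultiplier (d : ℕ) where
  /-- the power series -/
  symbol : Fock d
  /-- the operator of left multiplication by the power series -/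
  op : Fock d →L[ℂ] Fock d
  op_apply : ∀ (g : Fock d) (γ : FreeMonoid (Fin d)), op g γ = cauchyProduct symbol g γ

/-- A left multiplier is inner if its multiplication operator is an isometry. -/
def LeftMultiplier.IsInner {d : ℕ} (Θ : LeftMultiplier d) : Prop :=
  Isometry Θ.op

/-- An inner left multiplier `Θ` is Blaschke if the range of `Θ(L)` is the singularity space
of `Θ`. -/
def LeftMultiplier.IsBlaschke {d : ℕ} (Θ : LeftMultiplier d) : Prop :=
  Θ.IsInner ∧ Set.range Θ.op = singSpace Θ.symbol

/-! ### The left free shifts -/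

/-- The coefficients of `𝔷_i f`: the value at the word `iβ` is `f β`, and the value at every word
that does not begin with the letter `i` is zero. -/
def shiftFun {d : ℕ} (i : Fin d) (f : FreeMonoid (Fin d) → ℂ) : FreeMonoid (Fin d) → ℂ :=
  Function.extend (fun β => FreeMonoid.of i * β) f (fun _ => 0)

theorem of_mul_injective {d : ℕ} (i : Fin d) :
    Function.Injective (fun β : FreeMonoid (Fin d) => FreeMonoid.of i * β) :=
  fun _ _ h => mul_left_cancel h

theorem shiftFun_add {d : ℕ} (i : Fin d) (f g : FreeMonoid (Fin d) → ℂ) :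
    shiftFun i (f + g) = shiftFun i f + shiftFun i g := by
  have h := Function.extend_add (fun β => FreeMonoid.of i * β) f g (fun _ => 0) (fun _ => 0)
  have h0 : ((fun _ => 0) + (fun _ => 0) : FreeMonoid (Fin d) → ℂ) = fun _ => 0 := by
    funext; simp
  rw [h0] at h
  exact h

theorem shiftFun_smul {d : ℕ} (i : Fin d) (c : ℂ) (f : FreeMonoid (Fin d) → ℂ) :
    shiftFun i (c • f) = c • shiftFun i f := by
  have h := Function.extend_smul c (fun β => FreeMonoid.of i * β) f (fun _ => 0)
  have h0 : (c • (fun _ => 0) : FreeMonoid (Fin d) → ℂ) = fun _ => 0 := by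
    funext; simp
  rw [h0] at h
  exact h

theorem norm_shiftFun {d : ℕ} (i : Fin d) (f : FreeMonoid (Fin d) → ℂ) :
    (fun α => ‖shiftFun i f α‖ ^ (2 : ENNReal).toReal) =
      Function.extend (fun β => FreeMonoid.of i * β)
        (fun β => ‖f β‖ ^ (2 : ENNReal).toReal) 0 := by
  funext α
  by_cases h : ∃ β, FreeMonoid.of i * β = α
  · obtain ⟨β, rfl⟩ := h
    have h1 : shiftFun i f (FreeMonoid.of i * β) = f β := (of_mul_injective i).extend_apply f (fun _ => 0) β
    rw [h1]
    exact ((of_mul_injective i).extend_apply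
      (fun β => ‖f β‖ ^ (2 : ENNReal).toReal) 0 β).symm
  · have h1 : shiftFun i f α = 0 := Function.extend_apply' f (fun _ => 0) α h
    rw [h1, Function.extend_apply' _ _ _ h]
    simp

theorem memℓp_shiftFun {d : ℕ} (i : Fin d) (f : Fock d) : Memℓp (shiftFun i f) 2 := by
  have h2 : 0 < (2 : ENNReal).toReal := by simp
  refine memℓp_gen ?_
  rw [norm_shiftFun]
  exact (summable_extend_zero (of_mul_injective i)).2 ((lp.memℓp f).summable h2)

/-- The left free shift `L_i`, left multiplication by the variable `𝔷_i`; it is an isometry. -/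
def leftShift {d : ℕ} (i : Fin d) : Fock d →ₗᵢ[ℂ] Fock d where
  toFun f := ⟨shiftFun i f, memℓp_shiftFun i f⟩
  map_add' f g := by
    exact lp.ext (shiftFun_add i f g)
  map_smul' c f := by
    exact lp.ext (shiftFun_smul i c f)
  norm_map' f := by
    have h2 : 0 < (2 : ENNReal).toReal := by simp
    change ‖(⟨shiftFun i f, memℓp_shiftFun i f⟩ : Fock d)‖ = ‖f‖
    rw [lp.norm_eq_tsum_rpow h2, lp.norm_eq_tsum_rpow h2]
    congr 1
    change ∑' α, ‖shiftFun i f α‖ ^ (2 : ENNReal).toReal = _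
    rw [norm_shiftFun, tsum_extend_zero (of_mul_injective i)]

/-! ### Free polynomials -/

/-- The coefficient of the monomial `𝔷^α` in the free polynomial `p`. -/
def polyCoeff {d : ℕ} (p : FreeAlgebra ℂ (Fin d)) : FreeMonoid (Fin d) →₀ ℂ :=
  (FreeAlgebra.equivMonoidAlgebraFreeMonoid p).coeff

/-- A free polynomial is homogeneous of degree `m` if only monomials of words of length `m`
occur in it. -/
def IsHomogeneous {d : ℕ} (p : FreeAlgebra ℂ (Fin d)) (m : ℕ) : Prop :=
  ∀ α : FreeMonoid (Fin d), polyCoeff p α ≠ 0 → α.length = m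

/-- A free polynomial as an element of `H²`. -/
def polyFock {d : ℕ} (p : FreeAlgebra ℂ (Fin d)) : Fock d :=
  ⟨fun α => polyCoeff p α, (memℓp_zero (polyCoeff p).hasFiniteSupport).of_exponent_ge zero_le⟩

/-- The operator `p(L)`: the free polynomial `p` evaluated at the left free shifts. -/
def polyOp {d : ℕ} (p : FreeAlgebra ℂ (Fin d)) : Fock d →L[ℂ] Fock d :=
  FreeAlgebra.lift ℂ (fun i : Fin d => (leftShift i).toContinuousLinearMap) p

end NCHardy

end

noncomputable section

namespace NCHardy

open ContinuousLinearMap Filter Topology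

/-! For distinct words `α`, `β` of the same length the isometries `L^α` and `L^β` have orthogonal
ranges, since no word has both as prefixes. Hence for homogeneous `p` Pythagoras gives `‖p(L) g‖ =
‖p‖ ‖g‖` (`norm_polyOp_apply`). So `p(L)` has closed range, and `p / ‖p‖` is inner when `p ≠ 0`.

Evaluation is multiplicative, `(p g)(Z) = p(Z) g(Z)` (`eval_polyOp`), so `Ran p(L) ⊆ 𝒮(p)`.

For the converse let `η ⟂ Ran p(L)` and `0 ≤ r < 1`. By homogeneity `p(rL) = r^m p(L)`, so `(rL,
η)`, carried into `ℓ²(ℕ)` by an isometry `V`, lies in `Sing(p)`. Any `f ∈ 𝒮(p)` then satisfies `⟨η,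
f(rL) 1⟩ = 0`, and letting `r → 1` gives `⟨η, f⟩ = 0` (`inner_eq_zero_of_radial`). As the range is
closed, `f` belongs to it. -/

theorem leftShift_apply_of_mul {d : ℕ} (i : Fin d) (f : Fock d) (β : FreeMonoid (Fin d)) :
    leftShift i f (FreeMonoid.of i * β) = f β :=
  (of_mul_injective i).extend_apply f (fun _ => 0) β

theorem leftShift_apply_eq_zero {d : ℕ} (i : Fin d) (f : Fock d) {γ : FreeMonoid (Fin d)}
    (hγ : ¬∃ β, FreeMonoid.of i * β = γ) : leftShift i f γ = 0 :=
  Function.extend_apply' f (fun _ => 0) γ hγ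

/-! ### Convergence and multiplicativity of evaluation at strict row contractions. -/

section Evaluation

variable {d : ℕ} {E : Type*} [NormedAddCommGroup E] [InnerProductSpace ℂ E]

theorem rowOperator_apply (Z : Fin d → E →L[ℂ] E) (x : PiLp 2 (fun _ : Fin d => E)) :
    rowOperator Z x = ∑ i, Z i (x i) := by
  simp [rowOperator]

variable [CompleteSpace E]

theorem adjoint_rowOperator_apply (Z : Fin d → E →L[ℂ] E) (y : E) (i : Fin d) :
    adjoint (rowOperator Z) y i = adjoint (Z i) y := by
  refine ext_inner_left ℂ fun x => ?_
  have h : inner ℂ (WithLp.toLp 2 (Pi.single i x) : PiLp 2 (fun _ : Fin d => E))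
      (adjoint (rowOperator Z) y) = inner ℂ x (adjoint (rowOperator Z) y i) := by
    rw [PiLp.inner_apply, Finset.sum_eq_single i]
    · simp
    · intro j _ hj
      simp [hj]
    · simp
  rw [← h, adjoint_inner_right, adjoint_inner_right, rowOperator_apply, Finset.sum_eq_single i]
  · simp
  · intro j _ hj
    simp [hj]
  · simp

theorem sum_norm_adjoint_sq_le (Z : Fin d → E →L[ℂ] E) (y : E) :
    ∑ i, ‖adjoint (Z i) y‖ ^ 2 ≤ ‖rowOperator Z‖ ^ 2 * ‖y‖ ^ 2 := by
  have h : ‖adjoint (rowOperator Z) y‖ ≤ ‖rowOperator Z‖ * ‖y‖ := by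
    have := (adjoint (rowOperator Z)).le_opNorm y
    rwa [LinearIsometryEquiv.norm_map] at this
  have h2 : ‖adjoint (rowOperator Z) y‖ ^ 2 = ∑ i, ‖adjoint (Z i) y‖ ^ 2 := by
    rw [PiLp.norm_sq_eq_of_L2]
    simp only [adjoint_rowOperator_apply]
  rw [← h2, ← mul_pow]
  gcongr

instance : DecidableEq (FreeMonoid (Fin d)) :=
  inferInstanceAs (DecidableEq (List (Fin d)))

/-- The words of length less than `N`. -/
def shortWords (d : ℕ) : ℕ → Finset (FreeMonoid (Fin d))
  | 0 => ∅
  | N + 1 => insert 1 (Finset.univ.biUnion fun i : Fin d =>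
      (shortWords d N).map ⟨fun β => FreeMonoid.of i * β, of_mul_injective i⟩)

theorem mem_shortWords (α : FreeMonoid (Fin d)) : ∀ N, α.length < N → α ∈ shortWords d N := by
  induction α using FreeMonoid.inductionOn' with
  | one => intro N hN; cases N with
    | zero => simp at hN
    | succ N => simp [shortWords]
  | of_mul i α ih => intro N hN; cases N with
    | zero => simp at hN
    | succ N =>
      refine Finset.mem_insert_of_mem (Finset.mem_biUnion.2 ⟨i, Finset.mem_univ i, ?_⟩)
      refine Finset.mem_map.2 ⟨α, ih N ?_, rfl⟩
      simp [FreeMonoid.length_mul] at hN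
      omega

/-- Splitting off the first letter turns the sum at `y` into `‖y‖²` plus the sums at the vectors
`Z_i^* y`. The constant `C = (1 - ‖Z‖²)⁻¹` solves `1 + C ‖Z‖² = C`, so the bound survives the
induction. -/
theorem sum_shortWords_norm_adjoint_sq_le {Z : Fin d → E →L[ℂ] E} (hZ : IsStrictRowContraction Z)
    (N : ℕ) (y : E) :
    ∑ α ∈ shortWords d N, ‖adjoint (FreeMonoid.lift Z α) y‖ ^ 2 ≤
      (1 - ‖rowOperator Z‖ ^ 2)⁻¹ * ‖y‖ ^ 2 := by
  have hr : 0 < 1 - ‖rowOperator Z‖ ^ 2 := by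
    have h0 := norm_nonneg (rowOperator Z)
    have h1 : ‖rowOperator Z‖ < 1 := hZ
    nlinarith
  induction N generalizing y with
  | zero => simp only [shortWords, Finset.sum_empty]; positivity
  | succ N ih =>
    have hnot : (1 : FreeMonoid (Fin d)) ∉ Finset.univ.biUnion fun i : Fin d =>
        (shortWords d N).map ⟨fun β => FreeMonoid.of i * β, of_mul_injective i⟩ := by
      simp only [Finset.mem_biUnion, Finset.mem_map, not_exists, not_and]
      rintro i - α - h
      have := congrArg FreeMonoid.length h
      simp [FreeMonoid.length_mul] at this
    have hdisj : Set.PairwiseDisjoint (↑(Finset.univ : Finset (Fin d))) fun i : Fin d =>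
        (shortWords d N).map ⟨fun β => FreeMonoid.of i * β, of_mul_injective i⟩ := by
      intro i _ j _ hij
      refine Finset.disjoint_left.2 fun γ hi hj => hij ?_
      obtain ⟨α, -, rfl⟩ := Finset.mem_map.1 hi
      obtain ⟨β, -, h⟩ := Finset.mem_map.1 hj
      have h' : j :: β.toList = i :: α.toList := congrArg FreeMonoid.toList h
      exact (List.cons.inj h').1.symm
    rw [shortWords, Finset.sum_insert hnot, Finset.sum_biUnion hdisj]
    have hstep : ∀ i : Fin d, ∑ γ ∈ (shortWords d N).map
          ⟨fun β => FreeMonoid.of i * β, of_mul_injective i⟩,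
          ‖adjoint (FreeMonoid.lift Z γ) y‖ ^ 2 ≤
        (1 - ‖rowOperator Z‖ ^ 2)⁻¹ * ‖adjoint (Z i) y‖ ^ 2 := by
      intro i
      rw [Finset.sum_map]
      refine le_trans (le_of_eq (Finset.sum_congr rfl fun α _ => ?_)) (ih (adjoint (Z i) y))
      rw [Function.Embedding.coeFn_mk, map_mul, FreeMonoid.lift_eval_of, mul_def, adjoint_comp]
      rfl
    calc _ ≤ ‖y‖ ^ 2 + ∑ i, (1 - ‖rowOperator Z‖ ^ 2)⁻¹ * ‖adjoint (Z i) y‖ ^ 2 := by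
          refine add_le_add (le_of_eq ?_) (Finset.sum_le_sum fun i _ => hstep i)
          rw [map_one, one_def, adjoint_id]
          rfl
      _ ≤ ‖y‖ ^ 2 + (1 - ‖rowOperator Z‖ ^ 2)⁻¹ * (‖rowOperator Z‖ ^ 2 * ‖y‖ ^ 2) := by
          rw [← Finset.mul_sum]
          gcongr
          exact sum_norm_adjoint_sq_le Z y
      _ = (1 - ‖rowOperator Z‖ ^ 2)⁻¹ * ‖y‖ ^ 2 := by
          field_simp
          ring

theorem sum_norm_adjoint_lift_sq_le {Z : Fin d → E →L[ℂ] E} (hZ : IsStrictRowContraction Z)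
    (F : Finset (FreeMonoid (Fin d))) (y : E) :
    ∑ α ∈ F, ‖adjoint (FreeMonoid.lift Z α) y‖ ^ 2 ≤
      (1 - ‖rowOperator Z‖ ^ 2)⁻¹ * ‖y‖ ^ 2 := by
  refine le_trans (Finset.sum_le_sum_of_subset_of_nonneg (t := shortWords d (F.sup
    FreeMonoid.length + 1)) (fun α hα => ?_) fun _ _ _ => by positivity)
    (sum_shortWords_norm_adjoint_sq_le hZ _ y)
  exact mem_shortWords α _ (Nat.lt_succ_of_le (Finset.le_sup (f := FreeMonoid.length) hα))

/-- The square-sum bound concerns the adjoints of the `Z^α`, so the norm is computed on the adjoint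
side and Cauchy–Schwarz separates coefficients from words. This gives the Cauchy criterion in
`summable_eval`. -/
theorem norm_sum_smul_lift_le {Z : Fin d → E →L[ℂ] E} (hZ : IsStrictRowContraction Z)
    (F : Finset (FreeMonoid (Fin d))) (c : FreeMonoid (Fin d) → ℂ) :
    ‖∑ α ∈ F, c α • FreeMonoid.lift Z α‖ ≤
      √(∑ α ∈ F, ‖c α‖ ^ 2) * √((1 - ‖rowOperator Z‖ ^ 2)⁻¹) := by
  rw [← LinearIsometryEquiv.norm_map adjoint]
  refine opNorm_le_bound _ (by positivity) fun y => ?_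
  rw [map_sum, sum_apply]
  calc ‖∑ α ∈ F, adjoint (c α • FreeMonoid.lift Z α) y‖
      ≤ ∑ α ∈ F, ‖c α‖ * ‖adjoint (FreeMonoid.lift Z α) y‖ := by
        refine (norm_sum_le _ _).trans (le_of_eq (Finset.sum_congr rfl fun α _ => ?_))
        rw [map_smulₛₗ, smul_apply, norm_smul, RCLike.norm_conj]
    _ ≤ √(∑ α ∈ F, ‖c α‖ ^ 2) * √(∑ α ∈ F, ‖adjoint (FreeMonoid.lift Z α) y‖ ^ 2) :=
        Real.sum_mul_le_sqrt_mul_sqrt _ _ _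
    _ ≤ √(∑ α ∈ F, ‖c α‖ ^ 2) * √((1 - ‖rowOperator Z‖ ^ 2)⁻¹ * ‖y‖ ^ 2) := by
        gcongr
        exact sum_norm_adjoint_lift_sq_le hZ F y
    _ = _ := by
        rw [Real.sqrt_mul' _ (sq_nonneg _), Real.sqrt_sq (norm_nonneg y), mul_assoc]

theorem summable_norm_sq (f : Fock d) : Summable fun α => ‖f α‖ ^ 2 := by
  simpa using (lp.memℓp f).summable (by simp)

theorem summable_eval (f : Fock d) {Z : Fin d → E →L[ℂ] E} (hZ : IsStrictRowContraction Z) :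
    Summable fun α => f α • FreeMonoid.lift Z α := by
  rw [summable_iff_vanishing_norm]
  intro ε hε
  set C := √((1 - ‖rowOperator Z‖ ^ 2)⁻¹) with hC
  have hC0 : 0 ≤ C := Real.sqrt_nonneg _
  -- Dividing by `C + 1` needs only `0 ≤ C`.
  have hδ : 0 < (ε / (C + 1)) ^ 2 := by positivity
  obtain ⟨s, hs⟩ := summable_iff_vanishing_norm.1 (summable_norm_sq f) _ hδ
  refine ⟨s, fun t ht => (norm_sum_smul_lift_le hZ t _).trans_lt ?_⟩
  have h := hs t ht
  rw [Real.norm_of_nonneg (by positivity)] at h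
  have h' : √(∑ α ∈ t, ‖f α‖ ^ 2) < ε / (C + 1) := (Real.sqrt_lt' (by positivity)).2 h
  calc √(∑ α ∈ t, ‖f α‖ ^ 2) * C ≤ ε / (C + 1) * C := by gcongr
    _ < ε := by
      rw [div_mul_eq_mul_div, div_lt_iff₀ (by positivity)]
      nlinarith

theorem hasSum_eval (f : Fock d) {Z : Fin d → E →L[ℂ] E} (hZ : IsStrictRowContraction Z) :
    HasSum (fun α => f α • FreeMonoid.lift Z α) (eval f Z) :=
  (summable_eval f hZ).hasSum

theorem eval_add (f g : Fock d) {Z : Fin d → E →L[ℂ] E} (hZ : IsStrictRowContraction Z) :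
    eval (f + g) Z = eval f Z + eval g Z := by
  refine (hasSum_eval (f + g) hZ).unique ?_
  simpa [add_smul] using (hasSum_eval f hZ).add (hasSum_eval g hZ)

theorem eval_smul (c : ℂ) (f : Fock d) {Z : Fin d → E →L[ℂ] E} (hZ : IsStrictRowContraction Z) :
    eval (c • f) Z = c • eval f Z := by
  refine (hasSum_eval (c • f) hZ).unique ?_
  simpa [mul_smul] using (hasSum_eval f hZ).const_smul c

theorem eval_leftShift (i : Fin d) (f : Fock d) {Z : Fin d → E →L[ℂ] E}
    (hZ : IsStrictRowContraction Z) : eval (leftShift i f) Z = Z i * eval f Z := by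
  have h := (hasSum_eval f hZ).mul_left (Z i)
  refine (hasSum_eval _ hZ).unique ?_
  refine ((of_mul_injective i).hasSum_iff ?_).1 ?_
  · intro γ hγ
    rw [leftShift_apply_eq_zero i f hγ, zero_smul]
  · suffices he : (fun α => leftShift i f α • FreeMonoid.lift Z α) ∘
        (fun β => FreeMonoid.of i * β) = fun α => Z i * f α • FreeMonoid.lift Z α by
      rw [he]; exact h
    funext β
    simp only [Function.comp, leftShift_apply_of_mul, map_mul, FreeMonoid.lift_eval_of, mul_smul_comm]

theorem eval_polyOp (p : FreeAlgebra ℂ (Fin d)) (g : Fock d) {Z : Fin d → E →L[ℂ] E}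
    (hZ : IsStrictRowContraction Z) :
    eval (polyOp p g) Z = FreeAlgebra.lift ℂ Z p * eval g Z := by
  induction p using FreeAlgebra.induction generalizing g with
  | grade0 c =>
    have h : polyOp (algebraMap ℂ (FreeAlgebra ℂ (Fin d)) c) g = c • g := by
      rw [polyOp, AlgHom.commutes]
      rfl
    rw [h, AlgHom.commutes, eval_smul c g hZ, Algebra.algebraMap_eq_smul_one, smul_mul_assoc,
      one_mul]
  | grade1 i =>
    simpa [polyOp] using eval_leftShift i g hZ
  | mul a b ha hb =>
    have h : polyOp (a * b) g = polyOp a (polyOp b g) := by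
      simp only [polyOp, map_mul]
      rfl
    rw [h, ha, hb, map_mul, mul_assoc]
  | add a b ha hb =>
    have h : polyOp (a + b) g = polyOp a g + polyOp b g := by
      simp only [polyOp, map_add]
      rfl
    rw [h, eval_add _ _ hZ, ha, hb, map_add, add_mul]

end Evaluation

/-! ### Free polynomials as left multipliers; orthogonality of words of equal length. -/

section Polynomials

variable {d : ℕ}

/-- Used both for `p(Z)` on `E` and for `p(L)` on the Fock space. -/
theorem freeAlgebra_lift_eq_sum {A : Type*} [Ring A] [Algebra ℂ A] (F : Fin d → A)
    (p : FreeAlgebra ℂ (Fin d)) :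
    FreeAlgebra.lift ℂ F p = ∑ α ∈ (polyCoeff p).support, polyCoeff p α • FreeMonoid.lift F α := by
  have h : FreeAlgebra.lift ℂ F = (MonoidAlgebra.lift ℂ A (FreeMonoid (Fin d))
      (FreeMonoid.lift F)).comp
      (FreeAlgebra.equivMonoidAlgebraFreeMonoid : FreeAlgebra ℂ (Fin d) ≃ₐ[ℂ] _).toAlgHom := by
    ext i
    simp [FreeAlgebra.equivMonoidAlgebraFreeMonoid]
  rw [h]
  exact MonoidAlgebra.lift_apply _ _

theorem eval_polyFock {E : Type*} [NormedAddCommGroup E] [InnerProductSpace ℂ E]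
    (p : FreeAlgebra ℂ (Fin d)) (Z : Fin d → E →L[ℂ] E) :
    eval (polyFock p) Z = FreeAlgebra.lift ℂ Z p := by
  rw [freeAlgebra_lift_eq_sum]
  refine tsum_eq_sum fun α hα => ?_
  have h : polyFock p α = 0 := Finsupp.notMem_support_iff.1 hα
  rw [h, zero_smul]

theorem polyFock_smul (c : ℂ) (p : FreeAlgebra ℂ (Fin d)) :
    polyFock (c • p) = c • polyFock p := by
  refine lp.ext (funext fun α => ?_)
  change polyCoeff (c • p) α = c • polyCoeff p α
  simp [polyCoeff]

theorem polyOp_smul (c : ℂ) (p : FreeAlgebra ℂ (Fin d)) : polyOp (c • p) = c • polyOp p := by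
  simp only [polyOp, map_smul]

/-- The word `L^α` in the left free shifts. -/
def shiftWord : FreeMonoid (Fin d) →* (Fock d →L[ℂ] Fock d) :=
  FreeMonoid.lift fun i => (leftShift i).toContinuousLinearMap

theorem shiftWord_of_mul_apply (i : Fin d) (α : FreeMonoid (Fin d)) (g : Fock d) :
    shiftWord (FreeMonoid.of i * α) g = leftShift i (shiftWord α g) := by
  rw [map_mul, shiftWord, FreeMonoid.lift_eval_of]
  rfl

theorem norm_shiftWord (α : FreeMonoid (Fin d)) (g : Fock d) : ‖shiftWord α g‖ = ‖g‖ := by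
  induction α using FreeMonoid.inductionOn' with
  | one => rw [map_one]; rfl
  | of_mul i α ih => rw [shiftWord_of_mul_apply, LinearIsometry.norm_map, ih]

theorem shiftWord_apply_mul (α β : FreeMonoid (Fin d)) (g : Fock d) :
    shiftWord α g (α * β) = g β := by
  induction α using FreeMonoid.inductionOn' with
  | one => rw [map_one, one_mul]; rfl
  | of_mul i α ih => rw [shiftWord_of_mul_apply, mul_assoc, leftShift_apply_of_mul, ih]

theorem shiftWord_apply_eq_zero (α γ : FreeMonoid (Fin d)) (g : Fock d)
    (h : ¬∃ β, α * β = γ) : shiftWord α g γ = 0 := by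
  induction α using FreeMonoid.inductionOn' generalizing γ with
  | one => exact absurd ⟨γ, one_mul γ⟩ h
  | of_mul i α ih =>
    rw [shiftWord_of_mul_apply]
    by_cases hγ : ∃ β, FreeMonoid.of i * β = γ
    · obtain ⟨β, rfl⟩ := hγ
      rw [leftShift_apply_of_mul]
      refine ih β fun ⟨δ, hδ⟩ => h ⟨δ, ?_⟩
      rw [mul_assoc, hδ]
    · exact leftShift_apply_eq_zero i _ hγ

theorem inner_shiftWord_eq_zero {α β : FreeMonoid (Fin d)} (hl : α.length = β.length)
    (hne : α ≠ β) (g h : Fock d) : inner ℂ (shiftWord α g) (shiftWord β h) = 0 := by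
  rw [lp.inner_eq_tsum]
  refine (tsum_congr fun γ => ?_).trans tsum_zero
  by_cases h1 : ∃ δ, α * δ = γ
  · by_cases h2 : ∃ δ, β * δ = γ
    · obtain ⟨δ, rfl⟩ := h1
      obtain ⟨ε, hε⟩ := h2
      exact absurd (List.append_inj_left (s₁ := β.toList) (t₁ := ε.toList) (s₂ := α.toList)
        (t₂ := δ.toList) hε hl.symm).symm hne
    · rw [shiftWord_apply_eq_zero β γ h h2, inner_zero_right]
  · rw [shiftWord_apply_eq_zero α γ g h1, inner_zero_left]

theorem polyOp_apply (p : FreeAlgebra ℂ (Fin d)) (g : Fock d) :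
    polyOp p g = ∑ α ∈ (polyCoeff p).support, polyCoeff p α • shiftWord α g := by
  rw [polyOp, freeAlgebra_lift_eq_sum, sum_apply]
  rfl

/-- At most one cut of `γ` has prefix `α`, namely the one at position `α.length`. Expanding `p` in
words then yields the Cauchy product. -/
theorem sum_range_take_eq (α γ : FreeMonoid (Fin d)) (g : Fock d) :
    ∑ k ∈ Finset.range (γ.length + 1),
      (if FreeMonoid.ofList (γ.toList.take k) = α then
        g (FreeMonoid.ofList (γ.toList.drop k)) else 0) = shiftWord α g γ := by
  by_cases h : ∃ β, α * β = γ
  · obtain ⟨β, rfl⟩ := h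
    have hlist : (α * β).toList = α.toList ++ β.toList := rfl
    have hlen : (α * β).length = α.length + β.length := FreeMonoid.length_mul α β
    rw [shiftWord_apply_mul, Finset.sum_eq_single α.length]
    · have ht : FreeMonoid.ofList ((α * β).toList.take α.length) = α := by
        rw [hlist]; exact List.take_left' rfl
      have hd : FreeMonoid.ofList ((α * β).toList.drop α.length) = β := by
        rw [hlist]; exact List.drop_left' rfl
      rw [if_pos ht, hd]
    · intro k hk hne
      refine if_neg fun hα => hne ?_
      have h1 : ((α * β).toList.take k).length = α.length := congrArg FreeMonoid.length hα
      have h2 : (α * β).toList.length = α.length + β.length := hlen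
      rw [List.length_take, h2] at h1
      rw [Finset.mem_range, hlen] at hk
      omega
    · intro hα
      rw [Finset.mem_range, hlen] at hα
      omega
  · rw [shiftWord_apply_eq_zero α γ g h]
    refine Finset.sum_eq_zero fun k _ => if_neg fun hα => h
      ⟨FreeMonoid.ofList (γ.toList.drop k), ?_⟩
    rw [← hα]
    exact List.take_append_drop k γ.toList

theorem polyOp_apply_eq_cauchyProduct (p : FreeAlgebra ℂ (Fin d)) (g : Fock d)
    (γ : FreeMonoid (Fin d)) : polyOp p g γ = cauchyProduct (polyFock p) g γ := by
  have h1 : polyOp p g γ = ∑ α ∈ (polyCoeff p).support, polyCoeff p α * shiftWord α g γ := by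
    rw [polyOp_apply, lp.coeFn_sum, Finset.sum_apply]
    rfl
  rw [h1, cauchyProduct]
  simp_rw [← sum_range_take_eq, Finset.mul_sum]
  rw [Finset.sum_comm]
  refine Finset.sum_congr rfl fun k _ => ?_
  simp only [mul_ite, mul_zero, Finset.sum_ite_eq]
  split_ifs with h
  · rfl
  · have h0 : polyFock p (FreeMonoid.ofList (γ.toList.take k)) = 0 := Finsupp.notMem_support_iff.1 h
    rw [h0, zero_mul]

theorem norm_sq_sum_of_pairwise_orthogonal {ι H : Type*} [NormedAddCommGroup H]
    [InnerProductSpace ℂ H] (s : Finset ι) (v : ι → H)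
    (hv : ∀ i ∈ s, ∀ j ∈ s, i ≠ j → inner ℂ (v i) (v j) = 0) :
    ‖∑ i ∈ s, v i‖ ^ 2 = ∑ i ∈ s, ‖v i‖ ^ 2 := by
  have h : inner ℂ (∑ i ∈ s, v i) (∑ i ∈ s, v i) = ∑ i ∈ s, inner ℂ (v i) (v i) := by
    rw [sum_inner]
    refine Finset.sum_congr rfl fun i hi => ?_
    rw [inner_sum]
    exact Finset.sum_eq_single i (fun j hj hji => hv i hi j hj hji.symm) fun h => absurd hi h
  simp only [inner_self_eq_norm_sq_to_K] at h
  exact_mod_cast h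

theorem norm_sq_polyFock (p : FreeAlgebra ℂ (Fin d)) :
    ‖polyFock p‖ ^ 2 = ∑ α ∈ (polyCoeff p).support, ‖polyCoeff p α‖ ^ 2 := by
  have h := lp.norm_rpow_eq_tsum (p := 2) (by simp) (polyFock p)
  simp only [ENNReal.toReal_ofNat, Real.rpow_ofNat] at h
  rw [h]
  refine tsum_eq_sum fun α hα => ?_
  have h0 : polyFock p α = 0 := Finsupp.notMem_support_iff.1 hα
  simp [h0]

theorem norm_polyOp_apply {m : ℕ} {p : FreeAlgebra ℂ (Fin d)} (hp : IsHomogeneous p m)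
    (g : Fock d) : ‖polyOp p g‖ = ‖polyFock p‖ * ‖g‖ := by
  have h : ‖polyOp p g‖ ^ 2 = (‖polyFock p‖ * ‖g‖) ^ 2 := by
    rw [polyOp_apply, norm_sq_sum_of_pairwise_orthogonal, mul_pow, norm_sq_polyFock,
      Finset.sum_mul]
    · simp only [norm_smul, norm_shiftWord, mul_pow]
    · intro α hα β hβ hne
      rw [inner_smul_left, inner_smul_right, inner_shiftWord_eq_zero _ hne, mul_zero, mul_zero]
      rw [hp α (Finsupp.mem_support_iff.1 hα), hp β (Finsupp.mem_support_iff.1 hβ)]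
  exact (sq_eq_sq₀ (norm_nonneg _) (by positivity)).1 h

theorem isClosed_range_polyOp {m : ℕ} {p : FreeAlgebra ℂ (Fin d)} (hp : IsHomogeneous p m) :
    IsClosed (Set.range (polyOp p)) := by
  -- The antilipschitz bound requires `p ≠ 0`; for `p = 0` the range is `{0}`.
  by_cases h0 : ‖polyFock p‖ = 0
  · have h : polyOp p = 0 := by
      refine ContinuousLinearMap.ext fun g => ?_
      rw [zero_apply, ← norm_eq_zero, norm_polyOp_apply hp, h0, zero_mul]
    rw [h]
    simp
  · have h : AntilipschitzWith ‖polyFock p‖₊⁻¹ (polyOp p) := by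
      refine ContinuousLinearMap.antilipschitz_of_bound _ fun g => ?_
      rw [norm_polyOp_apply hp, NNReal.coe_inv, coe_nnnorm, inv_mul_cancel_left₀ h0]
    exact h.isClosed_range (polyOp p).uniformContinuous

end Polynomials

/-! ### Scaled shifts as points of the singularity locus, and the radial limit. -/

section Compression

variable {d : ℕ} {K : Type*} [NormedAddCommGroup K] [InnerProductSpace ℂ K] [CompleteSpace K]

/-- The scaled left shifts `r L`, transported to `K` along an isometric embedding of the Fock
space. -/
def transportedShift (V : Fock d →ₗᵢ[ℂ] K) (r : ℝ) (i : Fin d) : K →L[ℂ] K :=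
  (r : ℂ) • (V.toContinuousLinearMap ∘L (leftShift i).toContinuousLinearMap ∘L
    adjoint V.toContinuousLinearMap)

theorem transportedShift_apply (V : Fock d →ₗᵢ[ℂ] K) (r : ℝ) (i : Fin d) (x : K) :
    transportedShift V r i x =
      (r : ℂ) • V (leftShift i (adjoint V.toContinuousLinearMap x)) := rfl

theorem adjoint_isometry_apply (V : Fock d →ₗᵢ[ℂ] K) (g : Fock d) :
    adjoint V.toContinuousLinearMap (V g) = g := by
  refine ext_inner_left ℂ fun h => ?_
  rw [adjoint_inner_right]
  exact V.inner_map_map h g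

theorem norm_adjoint_isometry_apply_le (V : Fock d →ₗᵢ[ℂ] K) (x : K) :
    ‖adjoint V.toContinuousLinearMap x‖ ≤ ‖x‖ := by
  have h := (adjoint V.toContinuousLinearMap).le_opNorm x
  rw [LinearIsometryEquiv.norm_map] at h
  refine h.trans ?_
  have := V.norm_toContinuousLinearMap_le
  nlinarith [norm_nonneg x]

/-- The ranges of the `L_i` are mutually orthogonal, so `L` is a row isometry; `V` is isometric and
`V^*` contractive, leaving the factor `r`. -/
theorem isStrictRowContraction_transportedShift (V : Fock d →ₗᵢ[ℂ] K) {r : ℝ} (h0 : 0 ≤ r)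
    (h1 : r < 1) : IsStrictRowContraction (transportedShift V r) := by
  refine lt_of_le_of_lt (opNorm_le_bound _ h0 fun x => ?_) h1
  have hx : rowOperator (transportedShift V r) x =
      (r : ℂ) • V (∑ i, leftShift i (adjoint V.toContinuousLinearMap (x i))) := by
    simp only [rowOperator_apply, transportedShift_apply, map_sum, Finset.smul_sum]
  rw [hx, norm_smul, LinearIsometry.norm_map, Complex.norm_real, Real.norm_of_nonneg h0]
  refine mul_le_mul_of_nonneg_left ?_ h0
  refine (sq_le_sq₀ (norm_nonneg _) (norm_nonneg _)).1 ?_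
  rw [norm_sq_sum_of_pairwise_orthogonal, PiLp.norm_sq_eq_of_L2]
  · refine Finset.sum_le_sum fun i _ => ?_
    rw [LinearIsometry.norm_map]
    have := norm_adjoint_isometry_apply_le V (x i)
    gcongr
  · intro i _ j _ hij
    have h : ∀ (k : Fin d) (g : Fock d), leftShift k g = shiftWord (FreeMonoid.of k) g := by
      intro k g
      rw [shiftWord, FreeMonoid.lift_eval_of]
      rfl
    rw [h, h]
    exact inner_shiftWord_eq_zero (α := FreeMonoid.of i) (β := FreeMonoid.of j) rfl
      (FreeMonoid.of_injective.ne hij) _ _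

/-- Inner factors cancel through `V^* V = 1`. The outer `V^*` makes the formula hold for the empty
word too, where the left-hand operator on `K` is the identity and not `V V^*`. -/
theorem adjoint_lift_transportedShift (V : Fock d →ₗᵢ[ℂ] K) (r : ℝ) (α : FreeMonoid (Fin d))
    (x : K) :
    adjoint V.toContinuousLinearMap (FreeMonoid.lift (transportedShift V r) α x) =
      (r : ℂ) ^ α.length • shiftWord α (adjoint V.toContinuousLinearMap x) := by
  induction α using FreeMonoid.inductionOn' with
  | one => simp
  | of_mul i α ih =>
    have h : FreeMonoid.lift (transportedShift V r) (FreeMonoid.of i * α) x =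
        transportedShift V r i (FreeMonoid.lift (transportedShift V r) α x) := by
      rw [map_mul, FreeMonoid.lift_eval_of]
      rfl
    rw [h, transportedShift_apply, map_smul, adjoint_isometry_apply, ih, map_smul, smul_smul,
      shiftWord_of_mul_apply, FreeMonoid.length_mul, FreeMonoid.length_of, pow_add, pow_one]

theorem hasSum_inner_eval_transportedShift (V : Fock d →ₗᵢ[ℂ] K) {r : ℝ} (h0 : 0 ≤ r)
    (h1 : r < 1) (f η : Fock d) (x : K) :
    HasSum (fun α => f α * ((r : ℂ) ^ α.length *
        inner ℂ η (shiftWord α (adjoint V.toContinuousLinearMap x))))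
      (inner ℂ (V η) (eval f (transportedShift V r) x)) := by
  have h := (hasSum_eval f (isStrictRowContraction_transportedShift V h0 h1)).mapL
    ((innerSL ℂ (V η)) ∘L ContinuousLinearMap.apply ℂ K x)
  suffices he : (fun α => f α * ((r : ℂ) ^ α.length *
      inner ℂ η (shiftWord α (adjoint V.toContinuousLinearMap x)))) =
      fun α => ((innerSL ℂ (V η)) ∘L ContinuousLinearMap.apply ℂ K x)
        (f α • FreeMonoid.lift (transportedShift V r) α) by
    rw [he]
    exact h
  funext α
  symm
  change inner ℂ (V η) (f α • FreeMonoid.lift (transportedShift V r) α x) = _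
  have hV : inner ℂ (V η) (FreeMonoid.lift (transportedShift V r) α x) =
      inner ℂ η (adjoint V.toContinuousLinearMap
        (FreeMonoid.lift (transportedShift V r) α x)) :=
    (adjoint_inner_right V.toContinuousLinearMap η _).symm
  rw [inner_smul_right, hV, adjoint_lift_transportedShift, inner_smul_right]

/-- The constant power series `1`. -/
def vacuum (d : ℕ) : Fock d := lp.single 2 1 1

theorem inner_shiftWord_vacuum (η : Fock d) (α : FreeMonoid (Fin d)) :
    inner ℂ η (shiftWord α (vacuum d)) = starRingEnd ℂ (η α) := by
  rw [lp.inner_eq_tsum, tsum_eq_single α]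
  · have h := shiftWord_apply_mul α 1 (vacuum d)
    rw [mul_one] at h
    rw [h]
    simp [vacuum]
  · intro γ hγ
    suffices h : shiftWord α (vacuum d) γ = 0 by rw [h, inner_zero_right]
    by_cases hδ : ∃ δ, α * δ = γ
    · obtain ⟨δ, rfl⟩ := hδ
      rw [shiftWord_apply_mul]
      have : δ ≠ 1 := fun h => hγ (by rw [h, mul_one])
      simp [vacuum, this]
    · exact shiftWord_apply_eq_zero α γ _ hδ

/-- An Abel limit `r → 1⁻`: the terms are dominated by `‖f α‖ ‖η α‖`, which is summable. -/
theorem inner_eq_zero_of_radial (f η : Fock d)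
    (h : ∀ r : ℝ, 0 ≤ r → r < 1 →
      ∑' α, f α * ((r : ℂ) ^ α.length * starRingEnd ℂ (η α)) = 0) :
    inner ℂ η f = 0 := by
  have hsum : Summable fun α => ‖f α‖ * ‖η α‖ := by
    refine Summable.of_nonneg_of_le (fun _ => by positivity) (fun α => ?_)
      ((summable_norm_sq f).add (summable_norm_sq η))
    nlinarith [sq_nonneg (‖f α‖ - ‖η α‖), sq_nonneg (‖f α‖), sq_nonneg (‖η α‖)]
  have hlim : Tendsto (fun r : ℝ => ∑' α, f α * ((r : ℂ) ^ α.length * starRingEnd ℂ (η α)))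
      (𝓝[<] 1) (𝓝 (∑' α, f α * (1 * starRingEnd ℂ (η α)))) := by
    refine tendsto_tsum_of_dominated_convergence hsum (fun α => ?_) ?_
    · have hc : Continuous fun r : ℝ => f α * ((r : ℂ) ^ α.length * starRingEnd ℂ (η α)) := by
        fun_prop
      have := hc.tendsto 1
      rw [Complex.ofReal_one, one_pow] at this
      exact this.mono_left nhdsWithin_le_nhds
    · filter_upwards [Ioo_mem_nhdsLT (zero_lt_one (α := ℝ))] with r hr α
      rw [norm_mul, norm_mul, RCLike.norm_conj, norm_pow, Complex.norm_real,
        Real.norm_of_nonneg hr.1.le]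
      have : r ^ α.length ≤ 1 := pow_le_one₀ hr.1.le hr.2.le
      gcongr
      exact mul_le_of_le_one_left (norm_nonneg _) this
  have hzero : ∑' α, f α * (1 * starRingEnd ℂ (η α)) = 0 := by
    refine tendsto_nhds_unique hlim (tendsto_const_nhds.congr' ?_)
    filter_upwards [Ioo_mem_nhdsLT (zero_lt_one (α := ℝ))] with r hr
    exact (h r hr.1.le hr.2).symm
  rw [lp.inner_eq_tsum, ← hzero]
  refine tsum_congr fun α => ?_
  rw [one_mul]
  rfl

theorem mem_range_polyOp_of_mem_levelSingSpace (V : Fock d →ₗᵢ[ℂ] K) {m : ℕ}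
    {p : FreeAlgebra ℂ (Fin d)} (hp : IsHomogeneous p m) {f : Fock d}
    (hf : f ∈ levelSingSpace K (polyFock p)) : f ∈ Set.range (polyOp p) := by
  let R : Submodule ℂ (Fock d) := (polyOp p).range
  have hR : IsClosed (R : Set (Fock d)) := by
    have h : (R : Set (Fock d)) = Set.range (polyOp p) := LinearMap.coe_range _
    rw [h]
    exact isClosed_range_polyOp hp
  have : CompleteSpace R := hR.completeSpace_coe
  -- A closed subspace is its own double orthogonal complement.
  suffices h : f ∈ Rᗮᗮ by
    rw [Submodule.orthogonal_orthogonal] at h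
    exact h
  refine (Submodule.mem_orthogonal _ _).2 fun η hη => inner_eq_zero_of_radial f η ?_
  intro r h0 h1
  have hZ := isStrictRowContraction_transportedShift V h0 h1
  -- Homogeneity enters here: every word of `p` contributes the same factor `r ^ m`, leaving a
  -- multiple of `⟨η, p(L) V^* x⟩ = 0`.
  have hsing : (transportedShift V r, V η) ∈ singLocus K (polyFock p) := by
    refine ⟨hZ, fun x => ?_⟩
    have hs := hasSum_inner_eval_transportedShift V h0 h1 (polyFock p) η x
    have hfin : ∀ α ∉ (polyCoeff p).support, polyFock p α * ((r : ℂ) ^ α.length *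
        inner ℂ η (shiftWord α (adjoint V.toContinuousLinearMap x))) = 0 := by
      intro α hα
      have h : polyFock p α = 0 := Finsupp.notMem_support_iff.1 hα
      rw [h, zero_mul]
    refine (hs.unique (hasSum_sum_of_ne_finset_zero hfin)).trans ?_
    have horth : inner ℂ η (polyOp p (adjoint V.toContinuousLinearMap x)) = 0 :=
      (Submodule.mem_orthogonal' _ _).1 hη _ ⟨_, rfl⟩
    rw [polyOp_apply, inner_sum] at horth
    calc _ = (r : ℂ) ^ m * ∑ α ∈ (polyCoeff p).support,
          inner ℂ η (polyCoeff p α • shiftWord α (adjoint V.toContinuousLinearMap x)) := by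
          rw [Finset.mul_sum]
          refine Finset.sum_congr rfl fun α hα => ?_
          rw [hp α (Finsupp.mem_support_iff.1 hα), inner_smul_right]
          change polyCoeff p α * _ = _
          ring
      _ = 0 := by rw [horth, mul_zero]
  -- Testing on the vacuum recovers coefficients, since `L^α 1 = 𝔷^α`.
  have hs := hasSum_inner_eval_transportedShift V h0 h1 f η (V (vacuum d))
  rw [hf _ hsing] at hs
  simp only [adjoint_isometry_apply, inner_shiftWord_vacuum] at hs
  exact hs.tsum_eq

theorem polyOp_apply_mem_levelSingSpace (p : FreeAlgebra ℂ (Fin d)) (g : Fock d) :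
    polyOp p g ∈ levelSingSpace K (polyFock p) := by
  rintro ⟨Z, y⟩ ⟨hZ, hy⟩ x
  have h := hy (eval g Z x)
  rw [eval_polyFock] at h
  rw [eval_polyOp p g hZ]
  exact h

end Compression

/-! ### The singularity space of `p` and the Blaschke factor. -/

section Blaschke

variable {d m : ℕ}

instance : Encodable (FreeMonoid (Fin d)) :=
  inferInstanceAs (Encodable (List (Fin d)))

theorem orthonormal_single_encode : Orthonormal ℂ
    fun α : FreeMonoid (Fin d) => (lp.single 2 (Encodable.encode α) 1 : lp (fun _ : ℕ => ℂ) 2) := by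
  rw [orthonormal_iff_ite]
  intro α β
  rw [lp.inner_single_left]
  by_cases h : α = β
  · subst h; simp
  · have : Encodable.encode α ≠ Encodable.encode β := fun he => h (Encodable.encode_injective he)
    simp [h, this]

/-- An isometric embedding of the Fock space into `ℓ²(ℕ)`. -/
def fockEmbedding (d : ℕ) : Fock d →ₗᵢ[ℂ] lp (fun _ : ℕ => ℂ) 2 :=
  (orthonormal_single_encode (d := d)).orthogonalFamily.linearIsometry

/-- The infinite level alone forces membership in the range, as the Fock space embeds isometrically
in `ℓ²(ℕ)`. -/
theorem singSpace_polyFock {p : FreeAlgebra ℂ (Fin d)} (hp : IsHomogeneous p m) :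
    singSpace (polyFock p) = Set.range (polyOp p) := by
  refine Set.Subset.antisymm (fun f hf => ?_) ?_
  · exact mem_range_polyOp_of_mem_levelSingSpace (fockEmbedding d) hp hf.2
  · rintro _ ⟨g, rfl⟩
    exact ⟨fun n _ => polyOp_apply_mem_levelSingSpace p g,
      polyOp_apply_mem_levelSingSpace p g⟩

/-- A free polynomial as a left multiplier. -/
def polyMultiplier (p : FreeAlgebra ℂ (Fin d)) : LeftMultiplier d where
  symbol := polyFock p
  op := polyOp p
  op_apply := polyOp_apply_eq_cauchyProduct p

theorem isBlaschke_polyMultiplier {p : FreeAlgebra ℂ (Fin d)} (hp : IsHomogeneous p m)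
    (h1 : ‖polyFock p‖ = 1) : (polyMultiplier p).IsBlaschke := by
  refine ⟨AddMonoidHomClass.isometry_of_norm (polyOp p) fun g => ?_, (singSpace_polyFock hp).symm⟩
  rw [norm_polyOp_apply hp, h1, one_mul]

theorem isHomogeneous_smul {p : FreeAlgebra ℂ (Fin d)} (hp : IsHomogeneous p m) (c : ℂ) :
    IsHomogeneous (c • p) m := by
  intro α hα
  have h : polyFock (c • p) α ≠ 0 := hα
  rw [polyFock_smul] at h
  exact hp α (right_ne_zero_of_mul (a := c) h)

theorem polyCoeff_one : polyCoeff (1 : FreeAlgebra ℂ (Fin d)) = Finsupp.single 1 1 := by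
  rw [polyCoeff, map_one]
  rfl

theorem isHomogeneous_one : IsHomogeneous (1 : FreeAlgebra ℂ (Fin d)) 0 := by
  intro α hα
  rw [polyCoeff_one, Finsupp.single_apply] at hα
  split_ifs at hα with h
  · rw [← h]; rfl
  · exact absurd rfl hα

theorem norm_polyFock_one : ‖polyFock (1 : FreeAlgebra ℂ (Fin d))‖ = 1 := by
  have h := norm_sq_polyFock (1 : FreeAlgebra ℂ (Fin d))
  rw [polyCoeff_one, Finsupp.support_single _ one_ne_zero] at h
  rw [Finset.sum_singleton, Finsupp.single_eq_same, norm_one, one_pow] at h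
  exact (pow_eq_one_iff_of_nonneg (norm_nonneg _) two_ne_zero).1 h

theorem exists_isBlaschke_polyFock_eq_smul {p : FreeAlgebra ℂ (Fin d)}
    (hp : IsHomogeneous p m) : ∃ (c : ℂ) (B : LeftMultiplier d), B.IsBlaschke ∧
      polyFock p = c • B.symbol ∧ polyOp p = c • B.op := by
  by_cases h0 : ‖polyFock p‖ = 0
  -- The zero polynomial cannot be normalised, so `c = 0` is paired with the Blaschke inner `1`.
  · refine ⟨0, polyMultiplier 1, isBlaschke_polyMultiplier isHomogeneous_one norm_polyFock_one,
      ?_, ?_⟩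
    · rw [zero_smul]
      exact norm_eq_zero.1 h0
    · refine ContinuousLinearMap.ext fun g => ?_
      rw [zero_smul, zero_apply, ← norm_eq_zero, norm_polyOp_apply hp, h0, zero_mul]
  · have hc : (‖polyFock p‖ : ℂ) ≠ 0 := Complex.ofReal_ne_zero.2 h0
    refine ⟨‖polyFock p‖, polyMultiplier ((‖polyFock p‖ : ℂ)⁻¹ • p),
      isBlaschke_polyMultiplier (isHomogeneous_smul hp _) ?_, ?_, ?_⟩
    · rw [polyFock_smul, norm_smul, norm_inv, Complex.norm_real, norm_norm, inv_mul_cancel₀ h0]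
    · change polyFock p = _ • polyFock _
      rw [polyFock_smul, smul_inv_smul₀ hc]
    · change polyOp p = _ • polyOp _
      rw [polyOp_smul, smul_inv_smul₀ hc]

end Blaschke

end NCHardy

end

theorem mainTheorem10 (d m : ℕ) (p : FreeAlgebra ℂ (Fin d)) (hp : NCHardy.IsHomogeneous p m) :
    (∃ (c : ℂ) (B : NCHardy.LeftMultiplier d), B.IsBlaschke ∧
        NCHardy.polyFock p = c • B.symbol ∧ NCHardy.polyOp p = c • B.op) ∧
      NCHardy.singSpace (NCHardy.polyFock p) = Set.range (NCHardy.polyOp p) :=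
  ⟨NCHardy.exists_isBlaschke_polyFock_eq_smul hp, NCHardy.singSpace_polyFock hp⟩
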